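/- For $s\ge 0$ and $0\le t\le 1$ let $\mathfrak A_s^t$ be the set of all holomorphic functions $f$ on the open unit disk $\mathbb D$ with $f(0)=0$, $f'(0)=1$ and $$\operatorname{Re}\Big[(s-1)\frac{f(z)}{z}+f'(z)\Big]\ \ge\ st\qquad\text{for all } z\in\mathbb D\setminus\{0\},$$ and let $\mathfrak A_\infty^t$ be the set of all such normalized holomorphic functions $f$ with $\operatorname{Re}[f(z)/z]\ge t$ for all $z\in\mathbb D\setminus\{0\}$. Let $\mathfrak G$ be either the family $\mathfrak A=\{\mathfrak A_s^t:\ 0\le s<\infty,\ 0\le t\le 1\}$ or the extended family $\mathfrak A\cup\{\mathfrak A_\infty^t:\ 0\le t\le 1\}$, partially ordered by inclusion. For $A,B\in\mathfrak G$, call $Q\in\mathfrak G$ a quasi-supremum of $A,B$ in $\mathfrak G$ if $A\cup B\subseteq Q$ and there is no $T\in\mathfrak G$ with $A\cup B\subseteq T\subsetneq Q$. Then: 1. $\mathfrak G$ is not a lattice, i.e. it is not true that each pair of elements of $\mathfrak G$ has a unique supremum and a unique infimum in $\mathfrak G$. 2. There is a pair $A,B\in\mathfrak G$ with at least two distinct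 quasi-suprema in $\mathfrak G$. 3. If a pair $A,B\in\mathfrak G$ has a supremum $S$ in $\mathfrak G$, then $S$ is the unique quasi-supremum of $A,B$ in $\mathfrak G$. -/

import Mathlib

namespace HoloFamily

/-- The class of holomorphic functions on the open unit disk with `f 0 = 0` and `f' 0 = 1`.
A function on the disk is represented by its extension by zero to the whole plane, so that
each function on the disk has exactly one representative. -/
def normalizedClass : Set (ℂ → ℂ) :=
  {f | DifferentiableOn ℂ f (Metric.ball 0 1) ∧ (∀ z, z ∉ Metric.ball (0 : ℂ) 1 → f z = 0) ∧
    f 0 = 0 ∧ deriv f 0 = 1}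

/-- The parameter set `[0, ∞) × [0, 1)`. -/
def paramSet : Set (ℝ × ℝ) :=
  {p | 0 ≤ p.1 ∧ 0 ≤ p.2 ∧ p.2 < 1}

/-- The set of normalized `f` with `Re ((s - 1) f(z) / z + f'(z)) ≥ s t` on the punctured disk. -/
def classA (s t : ℝ) : Set (ℂ → ℂ) :=
  {f | f ∈ normalizedClass ∧ ∀ z ∈ Metric.ball (0 : ℂ) 1 \ {0},
    s * t ≤ (((s : ℂ) - 1) * (f z / z) + deriv f z).re}

/-- The limiting set for `s = ∞`: normalized `f` with `Re (f(z) / z) ≥ t` on the punctured disk. -/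
def classAInfty (t : ℝ) : Set (ℂ → ℂ) :=
  {f | f ∈ normalizedClass ∧ ∀ z ∈ Metric.ball (0 : ℂ) 1 \ {0}, t ≤ (f z / z).re}

/-- The two-parameter family of all `classA s t` with `(s, t)` in the closed parameter set. -/
def family : Set (Set (ℂ → ℂ)) :=
  {A | ∃ p ∈ closure paramSet, A = classA p.1 p.2}

/-- The same family with the limiting sets for `s = ∞` adjoined. -/
def extendedFamily : Set (Set (ℂ → ℂ)) :=
  family ∪ {A | ∃ t ∈ Set.Icc (0 : ℝ) 1, A = classAInfty t}

/-- A family of sets, partially ordered by inclusion, is a lattice if each pair of its elements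
has a unique supremum and a unique infimum in the family. (The order of the subtype `↥G` is
inclusion.) -/
def IsLatticeFamily {X : Type*} (G : Set (Set X)) : Prop :=
  ∀ A B : G, (∃! S : G, IsLUB {A, B} S) ∧ (∃! I : G, IsGLB {A, B} I)

/-- `Q` is a quasi-supremum of `A` and `B` in the family `G`: it contains `A ∪ B`, and no
element of the family that contains `A ∪ B` is a proper subset of `Q`. -/
def IsQuasiSup {X : Type*} (G : Set (Set X)) (A B Q : G) : Prop :=
  (A : Set X) ∪ B ⊆ Q ∧ ¬ ∃ T : G, (A : Set X) ∪ B ⊆ T ∧ (T : Set X) ⊂ Q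

end HoloFamily

namespace HoloFamily
open Complex Metric Set Filter Topology

/-! Write `L = 2 log 2 - 1`. The pair `classA 1 0`, `classA 2 (1/2)` has a quasi-supremum with `s =
2` and another with `s = 3`, both on the curve `s t = (s - 1) L`. Since a supremum is the only
quasi-supremum (`isQuasiSup_iff_eq_of_isLUB`), this pair has none.

On `classA 1 0` Harnack's inequality gives `Re (f z / z) ≥ L`, so both candidates contain the pair.
Conversely, the function solving `(s - 1) f/z + f' = s + 2 (1 - t) s z/(1 - z)` shows that
inclusions increase `s` (let `z → 1`) and that containing `classA 1 0` forces `s t ≤ (s - 1) L` (let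
`z → -1`). A smaller class `T` containing the pair therefore has `s` between 2 and that of the
candidate (`exists_params`). For `s = 2` this is immediate minimality; for `s = 3` the values `2 ≤ s
< 3` are excluded by `bound_of_classA_subset`. Working inside `extendedFamily` settles both families
at once. -/

/-! ### Power series of the extremal functions -/

/-- The series `∑ zⁿ / (s + n)` over `n ≥ 1`. -/
noncomputable def lerchSum (s : ℝ) (z : ℂ) : ℂ := ∑' n : ℕ, z ^ (n + 1) / ((s : ℂ) + n + 1)

lemma norm_lerchSum_term_le {s : ℝ} (hs : 0 ≤ s) {r : ℝ} {z : ℂ} (hz : ‖z‖ ≤ r) (n : ℕ) :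
    ‖z ^ (n + 1) / ((s : ℂ) + n + 1)‖ ≤ r ^ (n + 1) := by
  have h : (s : ℂ) + n + 1 = ((s + n + 1 : ℝ) : ℂ) := by push_cast; ring
  have h0 : (0 : ℝ) ≤ n := n.cast_nonneg
  rw [h, norm_div, norm_pow, Complex.norm_real, Real.norm_eq_abs, abs_of_pos (by positivity)]
  refine (div_le_self (by positivity) (by linarith)).trans ?_
  gcongr

lemma summable_pow_succ {r : ℝ} (h0 : 0 ≤ r) (h1 : r < 1) : Summable fun n : ℕ => r ^ (n + 1) :=
  (summable_nat_add_iff 1).2 (summable_geometric_of_lt_one h0 h1)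

lemma hasSum_lerchSum {s : ℝ} (hs : 0 ≤ s) {z : ℂ} (hz : ‖z‖ < 1) :
    HasSum (fun n : ℕ => z ^ (n + 1) / ((s : ℂ) + n + 1)) (lerchSum s z) :=
  (Summable.of_norm_bounded (summable_pow_succ (norm_nonneg z) hz)
    (norm_lerchSum_term_le hs le_rfl)).hasSum

lemma differentiableOn_lerchSum {s : ℝ} (hs : 0 ≤ s) :
    DifferentiableOn ℂ (lerchSum s) (ball 0 1) := by
  intro z hz
  obtain ⟨r, hr, hr1⟩ := exists_between (mem_ball_zero_iff.1 hz)
  have h0 : 0 ≤ r := (norm_nonneg z).trans hr.le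
  refine DifferentiableAt.differentiableWithinAt ?_
  refine (differentiableOn_tsum_of_summable_norm (U := ball 0 r) (summable_pow_succ h0 hr1)
    (fun n => by fun_prop) isOpen_ball
    (fun n w hw => norm_lerchSum_term_le hs (mem_ball_zero_iff.1 hw).le n)).differentiableAt
    (isOpen_ball.mem_nhds (mem_ball_zero_iff.2 hr))

lemma hasSum_pow_succ {z : ℂ} (hz : ‖z‖ < 1) : HasSum (fun n : ℕ => z ^ (n + 1)) (z / (1 - z)) := by
  simpa [pow_succ', div_eq_mul_inv] using (hasSum_geometric_of_norm_lt_one hz).mul_left z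

lemma mul_deriv_lerchSum_add {s : ℝ} (hs : 0 ≤ s) {z : ℂ} (hz : ‖z‖ < 1) :
    z * deriv (lerchSum s) z + s * lerchSum s z = z / (1 - z) := by
  obtain ⟨r, hr, hr1⟩ := exists_between hz
  have h0 : 0 ≤ r := (norm_nonneg z).trans hr.le
  have hd : HasSum _ (deriv (lerchSum s) z) :=
    hasSum_deriv_of_summable_norm (U := ball 0 r) (summable_pow_succ h0 hr1)
      (fun n => by fun_prop) isOpen_ball
      (fun n w hw => norm_lerchSum_term_le hs (mem_ball_zero_iff.1 hw).le n)
      (mem_ball_zero_iff.2 hr)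
  refine ((hd.mul_left z).add ((hasSum_lerchSum hs hz).mul_left (s : ℂ))).unique ?_
  refine (hasSum_pow_succ hz).congr_fun fun n => ?_
  have h : (s : ℂ) + n + 1 ≠ 0 := by
    have : (s : ℂ) + n + 1 = ((s + n + 1 : ℝ) : ℂ) := by push_cast; ring
    rw [this]
    exact_mod_cast (by positivity : s + n + 1 ≠ 0)
  rw [deriv_div_const, deriv_pow_field]
  field_simp
  push_cast
  ring

/-! ### Real parts -/

lemma neg_half_le_re_div_one_sub {z : ℂ} (hz : ‖z‖ < 1) : -(1 / 2) ≤ (z / (1 - z)).re := by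
  have h1 : normSq z < 1 := by
    rw [normSq_eq_norm_sq]; nlinarith [norm_nonneg z]
  have hne : 1 - z ≠ 0 := fun h => by
    rw [← sub_eq_zero.1 h] at hz; simp at hz
  have hp : 0 < normSq (1 - z) := normSq_pos.2 hne
  rw [div_re, ← add_div, le_div_iff₀ hp]
  simp only [normSq_apply, sub_re, sub_im, one_re, one_im] at *
  nlinarith

/-- The map `w / (1 + w)` inverts `z / (1 - z)` and sends `Re w > -1/2` into the disk; `-1/4` is a
convenient negative abscissa there. -/
lemma mobius_mem_ball (y : ℝ) :
    ‖(((-(1 / 4) : ℝ) : ℂ) + y * I) / (1 + (((-(1 / 4) : ℝ) : ℂ) + y * I))‖ < 1 := by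
  have hne : 1 + (((-(1 / 4) : ℝ) : ℂ) + y * I) ≠ 0 := fun h => by
    have := congrArg re h; norm_num at this
  rw [norm_div, div_lt_one (norm_pos_iff.2 hne), ← sq_lt_sq₀ (norm_nonneg _) (norm_nonneg _),
    ← normSq_eq_norm_sq, ← normSq_eq_norm_sq]
  simp [normSq_apply]
  nlinarith

/-- Each vertical line `Re (z / (1 - z)) = -1/4` lies in the disk and passes to the boundary
point `1`. -/
lemma exists_div_one_sub_eq (y : ℝ) :
    ∃ z : ℂ, ‖z‖ < 1 ∧ z ≠ 0 ∧ z / (1 - z) = ((-(1 / 4) : ℝ) : ℂ) + y * I ∧ |y| ≤ ‖1 - z‖⁻¹ := by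
  set w : ℂ := ((-(1 / 4) : ℝ) : ℂ) + y * I with hw
  have hne : 1 + w ≠ 0 := fun h => by have := congrArg re h; norm_num [hw] at this
  have hw0 : w ≠ 0 := fun h => by have := congrArg re h; norm_num [hw] at this
  have hz : 1 - w / (1 + w) = (1 + w)⁻¹ := by field_simp; ring
  refine ⟨w / (1 + w), mobius_mem_ball y, div_ne_zero hw0 hne, ?_, ?_⟩
  · rw [hz]; field_simp
  · rw [hz, norm_inv, inv_inv]
    simpa [hw] using abs_im_le_norm (1 + w)

/-- Coefficientwise comparison with `-log (1 - z)`: the coefficients differ by `O(1 / n ^ 2)`, so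
the difference is bounded on the disk. -/
lemma log_inv_norm_sub_le_re_lerchSum {s : ℝ} (hs : 0 ≤ s) :
    ∃ C : ℝ, ∀ z : ℂ, ‖z‖ < 1 → Real.log ‖1 - z‖⁻¹ - C ≤ (lerchSum s z).re := by
  have hsum : Summable fun n : ℕ => s / ((n : ℝ) + 1) ^ 2 := by
    have := (summable_nat_add_iff 1).2 (Real.summable_one_div_nat_pow.2 one_lt_two)
    simpa [div_eq_mul_inv] using this.mul_left s
  refine ⟨∑' n : ℕ, s / ((n : ℝ) + 1) ^ 2, fun z hz => ?_⟩
  have hlog : HasSum (fun n : ℕ => z ^ (n + 1) / ((n + 1 : ℕ) : ℂ)) (-log (1 - z)) := by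
    simpa using (hasSum_nat_add_iff' 1).2 (hasSum_taylorSeries_neg_log hz)
  have hd := (hlog.sub (hasSum_lerchSum hs hz))
  have hle : ‖-log (1 - z) - lerchSum s z‖ ≤ ∑' n : ℕ, s / ((n : ℝ) + 1) ^ 2 := by
    rw [← hd.tsum_eq]
    refine tsum_of_norm_bounded hsum.hasSum fun n => ?_
    have e : z ^ (n + 1) / ((n + 1 : ℕ) : ℂ) - z ^ (n + 1) / ((s : ℂ) + n + 1)
        = z ^ (n + 1) * ((s / ((n + 1) * (s + n + 1)) : ℝ) : ℂ) := by
      have h1 : (n : ℂ) + 1 ≠ 0 := by exact_mod_cast n.succ_ne_zero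
      have h2 : (s : ℂ) + n + 1 ≠ 0 := by
        have : (s : ℂ) + n + 1 = ((s + n + 1 : ℝ) : ℂ) := by push_cast; ring
        rw [this]
        exact_mod_cast (by positivity : s + n + 1 ≠ 0)
      push_cast
      field_simp
      ring
    rw [e, norm_mul, norm_pow, Complex.norm_real, Real.norm_eq_abs, abs_of_nonneg (by positivity)]
    refine (mul_le_of_le_one_left (by positivity) (pow_le_one₀ (norm_nonneg z) hz.le)).trans ?_
    rw [sq]
    gcongr
    linarith
  have := (re_le_norm _).trans hle
  rw [sub_re, neg_re, log_re] at this
  rw [Real.log_inv]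
  linarith

/-- Pairs of consecutive terms of the alternating series at `z = -r`. -/
lemma sum_pairs_le_neg_re_lerchSum {s : ℝ} (hs : 0 ≤ s) {r : ℝ} (h0 : 0 ≤ r) (h1 : r < 1) (N : ℕ) :
    ∑ k ∈ Finset.range N, (r ^ (2 * k + 1) / (s + 2 * k + 1) - r ^ (2 * k + 2) / (s + 2 * k + 2))
      ≤ -(lerchSum s (-(r : ℂ))).re := by
  have hz : ‖(-(r : ℂ))‖ < 1 := by simpa [abs_of_nonneg h0] using h1
  have hS : HasSum (fun n : ℕ => -((-r) ^ (n + 1) / (s + n + 1))) (-(lerchSum s (-(r : ℂ))).re) := by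
    have := (Complex.hasSum_re (hasSum_lerchSum hs hz)).neg
    refine this.congr_fun fun n => ?_
    have : (-(r : ℂ)) ^ (n + 1) / ((s : ℂ) + n + 1) = (((-r) ^ (n + 1) / (s + n + 1) : ℝ) : ℂ) := by
      push_cast; rfl
    rw [this, ofReal_re]
  have hle : ∀ n, ∑ i ∈ Finset.range (2 * n), -((-r) ^ (i + 1) / (s + i + 1))
      = ∑ k ∈ Finset.range n,
        (r ^ (2 * k + 1) / (s + 2 * k + 1) - r ^ (2 * k + 2) / (s + 2 * k + 2)) := by
    intro n
    induction n with
    | zero => simp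
    | succ n ih =>
      rw [show 2 * (n + 1) = 2 * n + 1 + 1 by ring, Finset.sum_range_succ, Finset.sum_range_succ, ih,
        Finset.sum_range_succ]
      have e1 : (-r) ^ (2 * n + 1) = -r ^ (2 * n + 1) := (odd_two_mul_add_one n).neg_pow r
      have e2 : (-r) ^ (2 * n + 1 + 1) = r ^ (2 * n + 2) :=
        Even.neg_pow (by exact ⟨n + 1, by ring⟩) r
      rw [e1, e2]
      push_cast
      ring
  have hmono : Monotone fun n => ∑ k ∈ Finset.range n,
      (r ^ (2 * k + 1) / (s + 2 * k + 1) - r ^ (2 * k + 2) / (s + 2 * k + 2)) := by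
    refine monotone_nat_of_le_succ fun n => ?_
    rw [Finset.sum_range_succ, le_add_iff_nonneg_right, sub_nonneg]
    gcongr ?_ / ?_
    · exact pow_le_pow_of_le_one h0 h1.le (by omega)
    · linarith
  have ht := hS.tendsto_sum_nat.comp (tendsto_id.const_mul_atTop' two_pos)
  refine hmono.ge_of_tendsto (ht.congr fun n => hle n) N

/-! ### Extremal functions -/

lemma deriv_indicator_ball {g : ℂ → ℂ} {z : ℂ} (hz : z ∈ ball (0 : ℂ) 1) :
    deriv ((ball (0 : ℂ) 1).indicator g) z = deriv g z :=
  Filter.EventuallyEq.deriv_eq <| by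
    filter_upwards [isOpen_ball.mem_nhds hz] with w hw using indicator_of_mem hw g

lemma indicator_mem_normalizedClass {g : ℂ → ℂ} (hg : DifferentiableOn ℂ g (ball 0 1))
    (h0 : g 0 = 0) (h1 : deriv g 0 = 1) : (ball (0 : ℂ) 1).indicator g ∈ normalizedClass := by
  have hm : (0 : ℂ) ∈ ball (0 : ℂ) 1 := mem_ball_self one_pos
  refine ⟨hg.congr fun z hz => indicator_of_mem hz g, fun z hz => indicator_of_notMem hz g, ?_, ?_⟩
  · rw [indicator_of_mem hm, h0]
  · rw [deriv_indicator_ball hm, h1]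

/-- The function `z + c z p(z)`, extended by zero. -/
noncomputable def perturbation (c : ℝ) (p : ℂ → ℂ) : ℂ → ℂ :=
  (ball (0 : ℂ) 1).indicator fun z => z + c * (z * p z)

lemma deriv_perturbation (c : ℝ) {p : ℂ → ℂ} (hp : DifferentiableOn ℂ p (ball 0 1)) {z : ℂ}
    (hz : z ∈ ball (0 : ℂ) 1) :
    deriv (perturbation c p) z = 1 + c * (p z + z * deriv p z) := by
  have h := (hp.differentiableAt (isOpen_ball.mem_nhds hz)).hasDerivAt
  rw [perturbation, deriv_indicator_ball hz]
  have := ((hasDerivAt_id' z).fun_add (((hasDerivAt_id' z).fun_mul h).const_mul (c : ℂ))).deriv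
  simpa using this

lemma perturbation_div (c : ℝ) (p : ℂ → ℂ) {z : ℂ} (hz : z ∈ ball (0 : ℂ) 1 \ {0}) :
    perturbation c p z / z = 1 + c * p z := by
  have : z ≠ 0 := hz.2
  rw [perturbation, indicator_of_mem hz.1]
  field_simp

lemma perturbation_mem_normalizedClass (c : ℝ) {p : ℂ → ℂ} (hp : DifferentiableOn ℂ p (ball 0 1))
    (h0 : p 0 = 0) : perturbation c p ∈ normalizedClass := by
  have hm : (0 : ℂ) ∈ ball (0 : ℂ) 1 := mem_ball_self one_pos
  refine indicator_mem_normalizedClass (by fun_prop) (by simp) ?_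
  rw [← deriv_indicator_ball hm]
  have := deriv_perturbation c hp hm
  simp only [h0, zero_mul, add_zero, mul_zero] at this
  exact this

lemma perturbation_functional (c a : ℝ) {p : ℂ → ℂ} (hp : DifferentiableOn ℂ p (ball 0 1)) {z : ℂ}
    (hz : z ∈ ball (0 : ℂ) 1 \ {0}) :
    (((a : ℂ) - 1) * (perturbation c p z / z) + deriv (perturbation c p) z).re
      = a + c * (z * deriv p z + a * p z).re := by
  rw [perturbation_div c p hz, deriv_perturbation c hp hz.1]
  have : ((a : ℂ) - 1) * (1 + c * p z) + (1 + c * (p z + z * deriv p z))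
      = (a : ℂ) + c * (z * deriv p z + a * p z) := by ring
  rw [this, add_re, re_ofReal_mul, ofReal_re]

/-- The extremal function of `classA s t`. -/
noncomputable def extremal (s t : ℝ) : ℂ → ℂ := perturbation (2 * (1 - t) * s) (lerchSum s)

lemma extremal_functional {s : ℝ} (hs : 0 ≤ s) (t a : ℝ) {z : ℂ} (hz : z ∈ ball (0 : ℂ) 1 \ {0}) :
    (((a : ℂ) - 1) * (extremal s t z / z) + deriv (extremal s t) z).re
      = a + 2 * (1 - t) * s * ((z / (1 - z)).re + (a - s) * (lerchSum s z).re) := by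
  rw [extremal, perturbation_functional _ _ (differentiableOn_lerchSum hs) hz,
    ← mul_deriv_lerchSum_add hs (mem_ball_zero_iff.1 hz.1)]
  simp only [add_re, re_ofReal_mul]
  ring

lemma extremal_mem_classA {s t : ℝ} (hs : 0 ≤ s) (ht : t ≤ 1) : extremal s t ∈ classA s t := by
  refine ⟨perturbation_mem_normalizedClass _ (differentiableOn_lerchSum hs)
    (by simp [lerchSum]), fun z hz => ?_⟩
  rw [extremal_functional hs t s hz]
  have := neg_half_le_re_div_one_sub (mem_ball_zero_iff.1 hz.1)
  nlinarith [mul_nonneg (sub_nonneg.2 ht) hs]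

/-! ### Necessary conditions for inclusion -/

/-- If `s' < s`, the term `(s' - s) Re (lerchSum s z)` tends to `-∞` as `z → 1` along the curve
where `Re (z / (1 - z))` stays `-1/4`. -/
lemma le_of_classA_subset {s t s' t' : ℝ} (hs : 0 < s) (ht : t < 1)
    (h : classA s t ⊆ classA s' t') : s ≤ s' := by
  by_contra! hlt
  obtain ⟨C, hC⟩ := log_inv_norm_sub_le_re_lerchSum hs.le
  have hc : 0 < 2 * (1 - t) * s := by nlinarith
  have hd : 0 < s - s' := sub_pos.2 hlt
  -- With this `K` the logarithmic term already uses up `s' - s' t'`; the remaining `-1/4` makes the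
  -- contradiction strict.
  set K := (s' - s' * t') / (2 * (1 - t) * s) / (s - s') + C with hK
  obtain ⟨z, hz, hz0, hw, hy⟩ := exists_div_one_sub_eq (Real.exp K)
  have hm := (h (extremal_mem_classA hs.le ht.le)).2 z ⟨mem_ball_zero_iff.2 hz, hz0⟩
  rw [extremal_functional hs.le t s' ⟨mem_ball_zero_iff.2 hz, hz0⟩, hw] at hm
  have hre : (((-(1 / 4) : ℝ) : ℂ) + (Real.exp K : ℝ) * I).re = -(1 / 4) := by simp
  rw [hre] at hm
  have hlog : K ≤ Real.log ‖1 - z‖⁻¹ := by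
    rw [abs_of_pos (Real.exp_pos K)] at hy
    exact (Real.le_log_iff_exp_le ((Real.exp_pos K).trans_le hy)).2 hy
  have hΦ : (s' - s' * t') / (2 * (1 - t) * s) / (s - s') ≤ (lerchSum s z).re := by
    linarith [hC z hz]
  rw [div_le_iff₀ hd, div_le_iff₀ hc] at hΦ
  nlinarith

/-- The derivative of `z + 2 (1 - t) z p(z)`, `p = z / (1 - z)`, contributes `p ^ 2`, whose real
part is unbounded below on the line `Re p = -1/4`. -/
lemma not_classAInfty_subset_classA {t s' t' : ℝ} (ht : t < 1) :
    ¬ classAInfty t ⊆ classA s' t' := by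
  intro h
  set p : ℂ → ℂ := fun z => z / (1 - z) with hp_def
  have hne : ∀ z ∈ ball (0 : ℂ) 1, 1 - z ≠ 0 := fun z hz h0 => by
    rw [← sub_eq_zero.1 h0] at hz; simp at hz
  have hp : DifferentiableOn ℂ p (ball 0 1) :=
    differentiableOn_id.div (by fun_prop) hne
  have hder : ∀ z ∈ ball (0 : ℂ) 1, z * deriv p z = p z + p z ^ 2 := fun z hz => by
    have h1 := hne z hz
    have : HasDerivAt p ((1 * (1 - z) - z * (-1)) / (1 - z) ^ 2) z :=
      (hasDerivAt_id z).div ((hasDerivAt_id z).const_sub 1) h1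
    rw [this.deriv, hp_def]
    field_simp
    ring
  have hmem : perturbation (2 * (1 - t)) p ∈ classAInfty t := by
    refine ⟨perturbation_mem_normalizedClass _ hp (by simp [hp_def]), fun z hz => ?_⟩
    rw [perturbation_div _ _ hz, add_re, one_re, re_ofReal_mul]
    have := neg_half_le_re_div_one_sub (mem_ball_zero_iff.1 hz.1)
    simp only [hp_def]
    nlinarith
  set K := |(s' - s' * t') / (2 * (1 - t))| + |s'| + 1 with hK
  have hK1 : 1 ≤ K := by
    rw [hK]; linarith [abs_nonneg ((s' - s' * t') / (2 * (1 - t))), abs_nonneg s']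
  obtain ⟨z, hz, hz0, hw, -⟩ := exists_div_one_sub_eq K
  have hzm : z ∈ ball (0 : ℂ) 1 \ {0} := ⟨mem_ball_zero_iff.2 hz, hz0⟩
  have hm := (h hmem).2 z hzm
  rw [perturbation_functional _ _ hp hzm, hder z hzm.1, show p z = _ from hw] at hm
  have hre : ((((-(1 / 4) : ℝ) : ℂ) + K * I) + (((-(1 / 4) : ℝ) : ℂ) + K * I) ^ 2
      + s' * (((-(1 / 4) : ℝ) : ℂ) + K * I)).re = -(1 / 4) + 1 / 16 - K ^ 2 - s' / 4 := by
    simp [sq]; ring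
  rw [hre] at hm
  have hc : 0 < 2 * (1 - t) := by linarith
  have h2 : (s' - s' * t') / (2 * (1 - t)) * (2 * (1 - t)) = s' - s' * t' :=
    div_mul_cancel₀ _ hc.ne'
  have h3 := le_abs_self ((s' - s' * t') / (2 * (1 - t)))
  have h4 := neg_abs_le s'
  have h5 : (s' - s' * t') / (2 * (1 - t)) + (-(1 / 4) + 1 / 16 - K ^ 2 - s' / 4) < 0 := by
    have hKK : K ≤ K ^ 2 := by nlinarith
    linarith [abs_nonneg s']
  nlinarith

/-- Testing the extremal function at `z = -r`. -/
lemma radial_bound_of_classA_subset {s t s' t' : ℝ} (hs : 0 ≤ s) (ht : t ≤ 1)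
    (h : classA s t ⊆ classA s' t') {r : ℝ} (h0 : 0 < r) (h1 : r < 1) :
    s' * t' ≤ s' + 2 * (1 - t) * s * (-r / (1 + r) + (s' - s) * (lerchSum s (-(r : ℂ))).re) := by
  have hz : (-(r : ℂ)) ∈ ball (0 : ℂ) 1 \ {0} := by
    refine ⟨mem_ball_zero_iff.2 (by simpa [abs_of_pos h0] using h1), ?_⟩
    simpa using h0.ne'
  have := (h (extremal_mem_classA hs ht)).2 _ hz
  rw [extremal_functional hs t s' hz] at this
  have e : (-(r : ℂ)) / (1 - -(r : ℂ)) = ((-r / (1 + r) : ℝ) : ℂ) := by push_cast; ring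
  rwa [e, ofReal_re] at this

/-- Truncating to finitely many pairs makes the limit `r → 1` a matter of continuity, with no
boundary value of the series needed. -/
lemma partial_sum_bound_of_classA_subset {s t s' t' : ℝ} (hs : 0 ≤ s) (hss : s ≤ s') (ht : t ≤ 1)
    (h : classA s t ⊆ classA s' t') (N : ℕ) :
    s * (1 - t) * (1 + 2 * (s' - s) *
      ∑ k ∈ Finset.range N, (1 / (s + 2 * k + 1) - 1 / (s + 2 * k + 2))) ≤ s' * (1 - t') := by
  have hev : ∀ᶠ r : ℝ in 𝓝[<] 1, s * (1 - t) * (2 * (r / (1 + r)) + 2 * (s' - s) *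
      ∑ k ∈ Finset.range N, (r ^ (2 * k + 1) / (s + 2 * k + 1) - r ^ (2 * k + 2) / (s + 2 * k + 2)))
      ≤ s' * (1 - t') := by
    filter_upwards [Ioo_mem_nhdsLT zero_lt_one] with r hr
    have h1 := radial_bound_of_classA_subset hs ht h hr.1 hr.2
    have h2 := sum_pairs_le_neg_re_lerchSum hs hr.1.le hr.2 N
    have h3 : 0 ≤ s * (1 - t) := mul_nonneg hs (sub_nonneg.2 ht)
    have h4 := mul_le_mul_of_nonneg_left
      (mul_le_mul_of_nonneg_left h2 (sub_nonneg.2 hss)) h3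
    rw [neg_div] at h1
    linarith
  have hc : ContinuousAt (fun r : ℝ => s * (1 - t) * (2 * (r / (1 + r)) + 2 * (s' - s) *
      ∑ k ∈ Finset.range N,
        (r ^ (2 * k + 1) / (s + 2 * k + 1) - r ^ (2 * k + 2) / (s + 2 * k + 2)))) 1 := by
    fun_prop (disch := norm_num)
  have := le_of_tendsto (hc.tendsto.mono_left nhdsWithin_le_nhds) hev
  norm_num at this ⊢
  exact this

lemma telescoping_bound {s : ℝ} (hs : 2 ≤ s) (N : ℕ) :
    1 / (2 * s + 5 / 4) - 1 / (2 * (s + 2 * N) + 5 / 4) ≤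
      ∑ k ∈ Finset.range N, (1 / (s + 2 * k + 1) - 1 / (s + 2 * k + 2)) := by
  induction N with
  | zero => simp
  | succ n ih =>
    rw [Finset.sum_range_succ]
    have key : 1 / (2 * (s + 2 * n) + 5 / 4) - 1 / (2 * (s + 2 * (n + 1 : ℕ)) + 5 / 4) ≤
        1 / (s + 2 * n + 1) - 1 / (s + 2 * n + 2) := by
      push_cast
      -- After clearing denominators the claim is `12 a + 8 ≤ 13 a + 105/16`, true for `a ≥ 2`; a
      -- shift of 1 in place of `5/4` would fail.
      set a : ℝ := s + 2 * n with ha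
      have ha2 : 2 ≤ a := by rw [ha]; linarith [(n.cast_nonneg : (0 : ℝ) ≤ n)]
      rw [show s + 2 * ((n : ℝ) + 1) = a + 2 by rw [ha]; ring,
        div_sub_div _ _ (by positivity) (by positivity),
        div_sub_div _ _ (by positivity) (by positivity),
        div_le_div_iff₀ (by positivity) (by positivity)]
      nlinarith
    linarith

/-- The limit of the preceding bounds, with the Lerch value at `-1` estimated from below. -/
lemma bound_of_classA_subset {s t s' t' : ℝ} (hs : 2 ≤ s) (hss : s ≤ s') (ht : t ≤ 1)
    (h : classA s t ⊆ classA s' t') :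
    s * (1 - t) * (1 + 2 * (s' - s) * (1 / (2 * s + 5 / 4))) ≤ s' * (1 - t') := by
  have hlim : Tendsto (fun N : ℕ => s * (1 - t) * (1 + 2 * (s' - s) *
      (1 / (2 * s + 5 / 4) - 1 / (2 * (s + 2 * (N : ℝ)) + 5 / 4)))) atTop
      (𝓝 (s * (1 - t) * (1 + 2 * (s' - s) * (1 / (2 * s + 5 / 4) - 0)))) := by
    refine ((Tendsto.const_mul _ (Tendsto.sub tendsto_const_nhds ?_)).const_add _).const_mul _
    simp only [one_div]
    refine tendsto_inv_atTop_zero.comp (tendsto_atTop_add_const_right _ _ ?_)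
    refine Tendsto.const_mul_atTop two_pos (tendsto_atTop_add_const_left _ _ ?_)
    exact tendsto_natCast_atTop_atTop.const_mul_atTop two_pos
  rw [sub_zero] at hlim
  refine le_of_tendsto' hlim fun N => ?_
  refine le_trans ?_ (partial_sum_bound_of_classA_subset (by linarith) hss ht h N)
  have h1 := telescoping_bound hs N
  have h2 : 0 ≤ s * (1 - t) := mul_nonneg (by linarith) (sub_nonneg.2 ht)
  have h3 : 0 ≤ 2 * (s' - s) := by linarith
  gcongr

lemma lerchSum_one_neg {r : ℝ} (h0 : 0 < r) (h1 : r < 1) :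
    (lerchSum 1 (-(r : ℂ))).re = Real.log (1 + r) / r - 1 := by
  have hz : ‖(-(r : ℂ))‖ < 1 := by simpa [abs_of_pos h0] using h1
  have hr : (r : ℂ) ≠ 0 := by exact_mod_cast h0.ne'
  -- The logarithm series loses its terms of index 0 (which is `1 / 0 = 0`) and 1; dividing by `z =
  -- -r` then gives `∑ z ^ (n + 1) / (n + 2)`.
  have hlog := (hasSum_nat_add_iff' 2).2 (hasSum_taylorSeries_neg_log hz)
  have h2 := (hlog.mul_left (-(r : ℂ))⁻¹).unique
    ((hasSum_lerchSum zero_le_one hz).congr_fun fun n => ?_)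
  · rw [← h2]
    have e : Complex.log (1 - -(r : ℂ)) = ((Real.log (1 + r) : ℝ) : ℂ) := by
      rw [ofReal_log (by linarith)]; push_cast; ring_nf
    rw [e]
    have e2 : (-(r : ℂ))⁻¹ * (-((Real.log (1 + r) : ℝ) : ℂ)
        - ∑ i ∈ Finset.range 2, (-(r : ℂ)) ^ i / (i : ℂ))
        = ((Real.log (1 + r) / r - 1 : ℝ) : ℂ) := by
      simp [Finset.sum_range_succ]
      field_simp
      ring
    rw [e2, ofReal_re]
  · have : (n : ℂ) + 2 ≠ 0 := by exact_mod_cast (by omega : n + 2 ≠ 0)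
    push_cast
    rw [show (1 : ℂ) + n + 1 = n + 2 by ring]
    field_simp
    ring

lemma bound_of_classA_one_subset {s' t' : ℝ} (h : classA 1 0 ⊆ classA s' t') :
    s' * t' ≤ (s' - 1) * (2 * Real.log 2 - 1) := by
  have hev : ∀ᶠ r : ℝ in 𝓝[<] 1, s' * t' ≤
      s' + 2 * (-r / (1 + r) + (s' - 1) * (Real.log (1 + r) / r - 1)) := by
    filter_upwards [Ioo_mem_nhdsLT zero_lt_one] with r hr
    have h1 := radial_bound_of_classA_subset zero_le_one zero_le_one h hr.1 hr.2
    rw [lerchSum_one_neg hr.1 hr.2] at h1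
    linarith
  have hc : ContinuousAt (fun r : ℝ =>
      s' + 2 * (-r / (1 + r) + (s' - 1) * (Real.log (1 + r) / r - 1))) 1 := by
    fun_prop (disch := norm_num)
  have := ge_of_tendsto (hc.tendsto.mono_left nhdsWithin_le_nhds) hev
  norm_num at this
  linarith

/-! ### Lower bounds for `Re (f(z) / z)` -/

/-- Harnack's lower bound for holomorphic functions with nonnegative real part. -/
lemma harnack_le_re {q : ℂ → ℂ} (hq : DifferentiableOn ℂ q (ball 0 1)) (h0 : q 0 = 1)
    (hre : ∀ z ∈ ball (0 : ℂ) 1, 0 ≤ (q z).re) {z : ℂ} (hz : ‖z‖ < 1) :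
    (1 - ‖z‖) / (1 + ‖z‖) ≤ (q z).re := by
  have hne : ∀ w ∈ ball (0 : ℂ) 1, 1 + q w ≠ 0 := fun w hw h => by
    have := congrArg re h
    simp at this
    linarith [hre w hw]
  have hm : ‖(1 - q z) / (1 + q z)‖ ≤ ‖z‖ := by
    refine norm_le_norm_of_mapsTo_ball (f := fun w => (1 - q w) / (1 + q w)) (R := 1)
      ((hq.const_sub 1).div (hq.const_add 1) hne) (fun w hw => ?_) (by simp [h0]) hz
    rw [mem_closedBall_zero_iff, norm_div]
    refine div_le_one_of_le₀ ?_ (norm_nonneg _)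
    rw [← sq_le_sq₀ (norm_nonneg _) (norm_nonneg _), ← normSq_eq_norm_sq, ← normSq_eq_norm_sq]
    simp only [normSq_apply, sub_re, sub_im, add_re, add_im, one_re, one_im]
    nlinarith [hre w hw]
  have hzm : z ∈ ball (0 : ℂ) 1 := mem_ball_zero_iff.2 hz
  have hn := norm_nonneg z
  rw [norm_div, div_le_iff₀ (norm_pos_iff.2 (hne z hzm)),
    ← sq_le_sq₀ (norm_nonneg _) (by positivity), mul_pow,
    ← normSq_eq_norm_sq (1 - q z), ← normSq_eq_norm_sq (1 + q z)] at hm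
  simp only [normSq_apply, sub_re, sub_im, add_re, add_im, one_re, one_im] at hm
  have hr := hre z hzm
  have h1 : (1 - (q z).re) ^ 2 ≤ (‖z‖ * (1 + (q z).re)) ^ 2 := by
    have : ‖z‖ ^ 2 ≤ 1 := by nlinarith
    nlinarith [mul_nonneg (sub_nonneg.2 this) (sq_nonneg (q z).im)]
  have h2 := (abs_le_of_sq_le_sq' h1 (by positivity)).2
  rw [div_le_iff₀ (by positivity)]
  linarith

lemma smul_mem_ball {z : ℂ} (hz : z ∈ ball (0 : ℂ) 1) {x : ℝ} (hx : x ∈ Icc (0 : ℝ) 1) :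
    (x : ℂ) * z ∈ ball (0 : ℂ) 1 := by
  rw [mem_ball_zero_iff] at *
  rw [norm_mul, Complex.norm_real, Real.norm_eq_abs, abs_of_nonneg hx.1]
  exact (mul_le_of_le_one_left (norm_nonneg z) hx.2).trans_lt hz

lemma hasDerivAt_re_radial {f : ℂ → ℂ} (hf : DifferentiableOn ℂ f (ball 0 1)) {z : ℂ}
    (hz : z ∈ ball (0 : ℂ) 1 \ {0}) {x : ℝ} (hx : x ∈ Icc (0 : ℝ) 1) :
    HasDerivAt (fun x : ℝ => (f (x * z) / z).re) (deriv f (x * z)).re x := by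
  have hz0 : z ≠ 0 := hz.2
  have h1 := (hf.differentiableAt (isOpen_ball.mem_nhds (smul_mem_ball hz.1 hx))).hasDerivAt
  have h2 : HasDerivAt (fun w : ℂ => f (w * z) / z) (deriv f (x * z)) (x : ℂ) := by
    have := (HasDerivAt.comp (x : ℂ) h1 ((hasDerivAt_id (x : ℂ)).mul_const z)).div_const z
    simpa [hz0] using this
  exact h2.real_of_complex

/-- Here `f z / z` is the integral of `f' (x z)` over `[0, 1]`, and Harnack's bound `(1 - x) / (1 +
x)` integrates to `2 log 2 - 1`. The integration is phrased as monotonicity in `x`. -/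
lemma le_re_div_of_mem_classA_one {f : ℂ → ℂ} (hf : f ∈ classA 1 0) {z : ℂ}
    (hz : z ∈ ball (0 : ℂ) 1 \ {0}) : 2 * Real.log 2 - 1 ≤ (f z / z).re := by
  obtain ⟨⟨hd, -, hf0, hf1⟩, hre⟩ := hf
  have hre' : ∀ w ∈ ball (0 : ℂ) 1, 0 ≤ (deriv f w).re := fun w hw => by
    rcases eq_or_ne w 0 with rfl | h0
    · simp [hf1]
    · simpa using hre w ⟨hw, h0⟩
  have hder : ∀ x ∈ Icc (0 : ℝ) 1,
      HasDerivAt (fun x : ℝ => (f (x * z) / z).re + x - 2 * Real.log (1 + x))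
        ((deriv f (x * z)).re + 1 - 2 * (1 / (1 + x))) x := fun x hx =>
    ((hasDerivAt_re_radial hd hz hx).add (hasDerivAt_id' x)).sub
      ((((hasDerivAt_id' x).const_add 1).log (by linarith [hx.1])).const_mul 2)
  have hmono : MonotoneOn (fun x : ℝ => (f (x * z) / z).re + x - 2 * Real.log (1 + x))
      (Icc 0 1) := by
    refine monotoneOn_of_deriv_nonneg (convex_Icc 0 1)
      (fun x hx => (hder x hx).continuousAt.continuousWithinAt)
      (fun x hx => (hder x (interior_subset hx)).differentiableAt.differentiableWithinAt)
      fun x hx => ?_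
    have hx' := interior_subset hx
    rw [(hder x hx').deriv]
    have hm := smul_mem_ball hz.1 hx'
    have h1 := harnack_le_re (hd.deriv isOpen_ball) hf1 hre' (mem_ball_zero_iff.1 hm)
    have hle : ‖(x : ℂ) * z‖ ≤ x := by
      rw [norm_mul, Complex.norm_real, Real.norm_eq_abs, abs_of_nonneg hx'.1]
      exact mul_le_of_le_one_right hx'.1 (mem_ball_zero_iff.1 hz.1).le
    have hx0 := hx'.1
    have h2 : (1 - x) / (1 + x) ≤ (1 - ‖(x : ℂ) * z‖) / (1 + ‖(x : ℂ) * z‖) := by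
      rw [div_le_div_iff₀ (by positivity) (by positivity)]
      nlinarith
    have h3 : (1 - x) / (1 + x) = 2 * (1 / (1 + x)) - 1 := by field_simp; ring
    linarith
  have := hmono (left_mem_Icc.2 zero_le_one) (right_mem_Icc.2 zero_le_one) zero_le_one
  norm_num [hf0] at this
  linarith

/-- The derivative of `x f(x z) / z` in `x` is `x` times the functional of `classA 2 t` at `x z`, so
its real part is at least `2 t x`. -/
lemma le_re_div_of_mem_classA_two {f : ℂ → ℂ} {t : ℝ} (hf : f ∈ classA 2 t) {z : ℂ}
    (hz : z ∈ ball (0 : ℂ) 1 \ {0}) : t ≤ (f z / z).re := by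
  obtain ⟨⟨hd, -, hf0, hf1⟩, hre⟩ := hf
  have hder : ∀ x ∈ Icc (0 : ℝ) 1,
      HasDerivAt (fun x : ℝ => x * (f (x * z) / z).re - t * x ^ 2)
        (1 * (f (x * z) / z).re + x * (deriv f (x * z)).re - t * (2 * x)) x := fun x hx => by
    simpa using ((hasDerivAt_id' x).fun_mul (hasDerivAt_re_radial hd hz hx)).fun_sub
      ((hasDerivAt_pow 2 x).const_mul t)
  have hmono : MonotoneOn (fun x : ℝ => x * (f (x * z) / z).re - t * x ^ 2) (Icc 0 1) := by
    refine monotoneOn_of_deriv_nonneg (convex_Icc 0 1)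
      (fun x hx => (hder x hx).continuousAt.continuousWithinAt)
      (fun x hx => (hder x (interior_subset hx)).differentiableAt.differentiableWithinAt)
      fun x hx => ?_
    have hx' := interior_subset hx
    rw [interior_Icc] at hx
    rw [(hder x hx').deriv]
    have hx0 : (x : ℂ) ≠ 0 := by exact_mod_cast hx.1.ne'
    have hz0 : z ≠ 0 := hz.2
    have h1 := hre (x * z) ⟨smul_mem_ball hz.1 hx', mul_ne_zero hx0 hz0⟩
    have h2 : f (x * z) / z = x * (f (x * z) / (x * z)) := by field_simp
    rw [h2, re_ofReal_mul]
    have h3 : (((2 : ℝ) : ℂ) - 1) * (f (x * z) / (x * z)) = f (x * z) / (x * z) := by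
      push_cast; ring
    rw [h3, add_re] at h1
    nlinarith [mul_le_mul_of_nonneg_left h1 hx.1.le]
  have := hmono (left_mem_Icc.2 zero_le_one) (right_mem_Icc.2 zero_le_one) zero_le_one
  norm_num [hf0] at this
  linarith

/-! ### Inclusions between classes -/

lemma classA_one_subset {s t : ℝ} (hs : 1 ≤ s) (h : s * t ≤ (s - 1) * (2 * Real.log 2 - 1)) :
    classA 1 0 ⊆ classA s t := fun f hf => ⟨hf.1, fun z hz => by
  have h1 := le_re_div_of_mem_classA_one hf hz
  have h2 := hf.2 z hz
  have e : (s : ℂ) - 1 = ((s - 1 : ℝ) : ℂ) := by push_cast; ring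
  simp only [ofReal_one, sub_self, zero_mul, zero_add, mul_zero] at h2
  rw [e, add_re, re_ofReal_mul]
  linarith [mul_le_mul_of_nonneg_left h1 (sub_nonneg.2 hs)]⟩

lemma classA_two_subset {s t t' : ℝ} (hs : 2 ≤ s) (h : s * t' ≤ s * t) :
    classA 2 t ⊆ classA s t' := fun f hf => ⟨hf.1, fun z hz => by
  have h1 := le_re_div_of_mem_classA_two hf hz
  have h2 := hf.2 z hz
  have e : ((s : ℂ) - 1) * (f z / z) + deriv f z
      = ((s - 2 : ℝ) : ℂ) * (f z / z) + ((((2 : ℝ) : ℂ) - 1) * (f z / z) + deriv f z) := by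
    push_cast; ring
  rw [e, add_re, re_ofReal_mul]
  linarith [mul_le_mul_of_nonneg_left h1 (sub_nonneg.2 hs)]⟩

lemma classA_subset_of_le {s t t' : ℝ} (h : s * t' ≤ s * t) : classA s t ⊆ classA s t' :=
  fun _ hf => ⟨hf.1, fun z hz => h.trans (hf.2 z hz)⟩

/-! ### The family as an ordered set -/

lemma classA_mem_family {s t : ℝ} (hs : 0 ≤ s) (h0 : 0 ≤ t) (h1 : t < 1) : classA s t ∈ family :=
  ⟨(s, t), subset_closure ⟨hs, h0, h1⟩, rfl⟩

lemma not_classA_one_subset_classAInfty_one : ¬ classA 1 0 ⊆ classAInfty 1 := fun h => by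
  have hz : (-((1 / 2 : ℝ) : ℂ)) ∈ ball (0 : ℂ) 1 \ {0} := by
    refine ⟨mem_ball_zero_iff.2 ?_, ?_⟩ <;> norm_num
  have h1 := (h (extremal_mem_classA zero_le_one zero_le_one)).2 _ hz
  rw [extremal, perturbation_div _ _ hz, add_re, one_re, re_ofReal_mul] at h1
  have h2 := sum_pairs_le_neg_re_lerchSum zero_le_one (r := 1 / 2) (by norm_num) (by norm_num) 1
  norm_num at h1 h2
  linarith

/-- An element of the extended family between `classA 1 0 ∪ classA 2 (1 / 2)` and some `classA s t`
is itself of the form `classA s' t'`. -/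
lemma exists_params {T : Set (ℂ → ℂ)} (hT : T ∈ extendedFamily)
    (hA : classA 1 0 ⊆ T) (hB : classA 2 (1 / 2) ⊆ T) {s t : ℝ} (hQ : T ⊆ classA s t) :
    ∃ s' t', T = classA s' t' ∧ 2 ≤ s' ∧ s' ≤ s ∧ t' < 1 ∧
      s' * t' ≤ (s' - 1) * (2 * Real.log 2 - 1) := by
  have hlog := Real.log_two_lt_d9
  rcases hT with ⟨⟨s', t'⟩, hp, rfl⟩ | ⟨t', ht', rfl⟩
  · have h2 : 2 ≤ s' := le_of_classA_subset two_pos (by norm_num) hB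
    have h3 := bound_of_classA_one_subset hA
    have h4 : t' < 1 := by
      -- If `t' ≥ 1`, then `s' ≤ s' t' ≤ (s' - 1) L`, impossible because `L < 1`.
      by_contra! h
      nlinarith
    exact ⟨s', t', rfl, h2, le_of_classA_subset (by linarith) h4 hQ, h4, h3⟩
  · rcases ht'.2.lt_or_eq with h | rfl
    · exact absurd hQ (not_classAInfty_subset_classA h)
    · exact absurd hA not_classA_one_subset_classAInfty_one

theorem isQuasiSup_classA_two {G : Set (Set (ℂ → ℂ))} (hG : G ⊆ extendedFamily) {A B Q : G}
    (hA : (A : Set (ℂ → ℂ)) = classA 1 0) (hB : (B : Set (ℂ → ℂ)) = classA 2 (1 / 2))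
    (hQ : (Q : Set (ℂ → ℂ)) = classA 2 ((2 * Real.log 2 - 1) / 2)) : IsQuasiSup G A B Q := by
  have hlog := Real.log_two_lt_d9
  rw [IsQuasiSup, hA, hB, hQ]
  refine ⟨union_subset (classA_one_subset one_le_two (by linarith))
    (classA_two_subset le_rfl (by linarith)), ?_⟩
  rintro ⟨⟨T, hT⟩, hU, hTQ⟩
  obtain ⟨s, t, rfl, h2, hs, -, h⟩ := exists_params (hG hT) (subset_union_left.trans hU)
    (subset_union_right.trans hU) hTQ.1
  obtain rfl : s = 2 := le_antisymm hs h2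
  exact hTQ.2 (classA_subset_of_le (by linarith))

theorem isQuasiSup_classA_three {G : Set (Set (ℂ → ℂ))} (hG : G ⊆ extendedFamily) {A B Q : G}
    (hA : (A : Set (ℂ → ℂ)) = classA 1 0) (hB : (B : Set (ℂ → ℂ)) = classA 2 (1 / 2))
    (hQ : (Q : Set (ℂ → ℂ)) = classA 3 (2 * (2 * Real.log 2 - 1) / 3)) : IsQuasiSup G A B Q := by
  have hlog := Real.log_two_lt_d9
  have hlog' := Real.log_two_gt_d9
  rw [IsQuasiSup, hA, hB, hQ]
  refine ⟨union_subset (classA_one_subset (by norm_num) (by linarith))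
    (classA_two_subset (by norm_num) (by linarith)), ?_⟩
  rintro ⟨⟨T, hT⟩, hU, hTQ⟩
  obtain ⟨s, t, rfl, h2, hs, ht, h⟩ := exists_params (hG hT) (subset_union_left.trans hU)
    (subset_union_right.trans hU) hTQ.1
  rcases hs.lt_or_eq with hs | rfl
  · have hb := bound_of_classA_subset h2 hs.le ht.le hTQ.1
    have hp : 0 < 2 * s + 5 / 4 := by linarith
    have e : s * (1 - t) * (1 + 2 * (3 - s) * (1 / (2 * s + 5 / 4)))
        = s * (1 - t) * (29 / 4) / (2 * s + 5 / 4) := by field_simp; ring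
    rw [e, div_le_iff₀ hp] at hb
    -- Since `s (1 - t) ≥ s - (s - 1) L`, `hb` would give `(s - 3) (5 - 13 L) / 4 ≤ 0`. But `s < 3`,
    -- and `L > 5/13` (about `0.3863` against `0.3846`), so the shift `5/4` is only just small
    -- enough.
    nlinarith
  · exact hTQ.2 (classA_subset_of_le (by linarith))

theorem isQuasiSup_iff_eq_of_isLUB {X : Type*} {G : Set (Set X)} {A B S : G}
    (hS : IsLUB {A, B} S) (Q : G) : IsQuasiSup G A B Q ↔ Q = S := by
  have hle : ∀ T : G, (A : Set X) ∪ B ⊆ T ↔ S ≤ T := fun T => by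
    rw [isLUB_le_iff hS, upperBounds_insert, upperBounds_singleton, union_subset_iff]
    rfl
  constructor
  · rintro ⟨h1, h2⟩
    refine le_antisymm ?_ ((hle Q).1 h1)
    by_contra h
    exact h2 ⟨S, (hle S).2 le_rfl, (hle Q).1 h1, h⟩
  · rintro rfl
    exact ⟨(hle Q).2 le_rfl, fun ⟨T, h1, h2⟩ => h2.2 ((hle T).1 h1)⟩

end HoloFamily

theorem corollary4p5 :
    ∀ G ∈ ({HoloFamily.family, HoloFamily.extendedFamily} : Set (Set (Set (ℂ → ℂ)))),
      ¬ HoloFamily.IsLatticeFamily G ∧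
      (∃ A B Q₁ Q₂ : G, HoloFamily.IsQuasiSup G A B Q₁ ∧ HoloFamily.IsQuasiSup G A B Q₂ ∧
        Q₁ ≠ Q₂) ∧
      (∀ A B S : G, IsLUB {A, B} S → ∀ Q : G, HoloFamily.IsQuasiSup G A B Q ↔ Q = S) := by
  intro G hG
  have hsub : HoloFamily.family ⊆ G ∧ G ⊆ HoloFamily.extendedFamily := by
    rcases hG with rfl | rfl
    · exact ⟨subset_rfl, Set.subset_union_left⟩
    · exact ⟨Set.subset_union_left, subset_rfl⟩
  have hlog := Real.log_two_lt_d9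
  have hlog' := Real.log_two_gt_d9
  have hquasi : ∃ A B Q₁ Q₂ : G, HoloFamily.IsQuasiSup G A B Q₁ ∧
      HoloFamily.IsQuasiSup G A B Q₂ ∧ Q₁ ≠ Q₂ := by
    refine ⟨⟨_, hsub.1 (HoloFamily.classA_mem_family zero_le_one le_rfl one_pos)⟩,
      ⟨_, hsub.1 (HoloFamily.classA_mem_family (t := 1 / 2) zero_le_two (by norm_num)
        (by norm_num))⟩,
      ⟨_, hsub.1 (HoloFamily.classA_mem_family (t := (2 * Real.log 2 - 1) / 2) zero_le_two
        (by linarith) (by linarith))⟩,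
      ⟨_, hsub.1 (HoloFamily.classA_mem_family (s := 3) (t := 2 * (2 * Real.log 2 - 1) / 3)
        (by norm_num) (by linarith) (by linarith))⟩,
      HoloFamily.isQuasiSup_classA_two hsub.2 rfl rfl rfl,
      HoloFamily.isQuasiSup_classA_three hsub.2 rfl rfl rfl, fun h => ?_⟩
    have := HoloFamily.le_of_classA_subset (by norm_num) (by linarith)
      (Subtype.ext_iff.1 h).symm.subset
    norm_num at this
  refine ⟨fun hlat => ?_, hquasi, fun A B S hS Q => HoloFamily.isQuasiSup_iff_eq_of_isLUB hS Q⟩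
  obtain ⟨A, B, Q₁, Q₂, h1, h2, hne⟩ := hquasi
  obtain ⟨S, hS, -⟩ := (hlat A B).1
  exact hne (((HoloFamily.isQuasiSup_iff_eq_of_isLUB hS _).1 h1).trans
    ((HoloFamily.isQuasiSup_iff_eq_of_isLUB hS _).1 h2).symm)
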